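/- Let $G$ be a finite group. A symmetric sequence $A_\bullet$ in $G$-sets is a family of (possibly infinite) $(G\times\Sigma_n)$-sets $A_n$, $n\ge 0$; let $N\mathbf{Sym}$ be the class of those for which every $\Sigma_n$ acts freely on $A_n$ and $A_n^{H\times\{e\}}\neq\varnothing$ for every $n\ge 0$ and every subgroup $H\subset G$. For $A_\bullet\in N\mathbf{Sym}$ and a subgroup $H\subset G$, a finite $H$-set $T$ is called admissible for $A_\bullet$ if, for some homomorphism $\alpha:H\to\Sigma_n$, $T$ is isomorphic to $\{1,\dots,n\}$ with the $H$-action $\alpha$, and $A_n$ has a point fixed by $\{(h,\alpha(h)) \mid h\in H\}\subset G\times\Sigma_n$. Let $\mathbb A(A)$ be the collection, indexed by the subgroups $H\subset G$, of the classes of admissible finite $H$-sets. It is a coefficient system: it contains all finite sets with trivial action and is closed under isomorphism, restriction to subgroups and conjugation by elements of $G$. A coefficient system $\mathcal F$ is an indexing system if every $\mathcal F(H)$ is moreover closed under subobjects and finite coproducts, and if $T\in\mathcal F(K)$ and $H/K\in\mathcal F(H)$ imply $H\times_K T\in\mathcal F(H)$ for all subgroups $K\subset H\subset G$. For a coefficient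 system $\mathcal C$ let $\mathbb I(\mathcal C)$ be the smallest indexing system containing $\mathcal C$. Theorem. For every $A_\bullet\in N\mathbf{Sym}$, the symmetric sequence underlying the free operad $\mathbb F(A)$ in $G$-sets on $A_\bullet$ is again in $N\mathbf{Sym}$, and the admissible sets of $\mathbb F(A)$ form the indexing system generated by the admissible sets of $A_\bullet$: $$\mathbb A(\mathbb F(A))=\mathbb I(\mathbb A(A)).$$ -/

import Mathlib

open Equiv

universe u v w

namespace EquivariantOperad

/-! ## Finite `H`-sets -/

/-- A finite set with a left action of the group `H`. -/
structure FinGSet (H : Type u) [Group H] where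
  carrier : Type u
  [finite : Finite carrier]
  [action : MulAction H carrier]

attribute [instance] FinGSet.finite FinGSet.action

instance {H : Type u} [Group H] : CoeSort (FinGSet H) (Type u) := ⟨FinGSet.carrier⟩

namespace FinGSet

variable {H : Type u} [Group H] {K : Type u} [Group K]

/-- Two finite `H`-sets are isomorphic: there is an equivariant bijection. -/
def IsIso (S T : FinGSet H) : Prop :=
  ∃ e : S ≃ T, ∀ (h : H) (s : S), e (h • s) = h • e s

/-- `S` is (isomorphic to) a subobject of `T`: there is an equivariant injection `S → T`. -/
def IsSubobject (S T : FinGSet H) : Prop :=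
  ∃ f : S → T, Function.Injective f ∧ ∀ (h : H) (s : S), f (h • s) = h • f s

/-- The action is trivial. -/
def IsTrivial (T : FinGSet H) : Prop :=
  ∀ (h : H) (t : T), h • t = t

/-- Pull back an `H`-action along a group homomorphism `f : K → H`. -/
def comap (f : K →* H) (T : FinGSet H) : FinGSet K where
  carrier := T
  action := MulAction.compHom T f

/-- The coproduct (disjoint union) of a finite family of finite `H`-sets. -/
def coprod {ι : Type} [Finite ι] (T : ι → FinGSet H) : FinGSet H where
  carrier := Σ i, T i

end FinGSet

section Subgroups

variable {G : Type u} [Group G]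

/-- The restriction of an `H`-set to a subgroup `K ≤ H`. -/
def res {K H : Subgroup G} (hKH : K ≤ H) (T : FinGSet H) : FinGSet K :=
  T.comap (Subgroup.inclusion hKH)

/-- The conjugate `aHa⁻¹`. -/
def conjSubgroup (a : G) (H : Subgroup G) : Subgroup G :=
  H.map (MulAut.conj a : G ≃* G).toMonoidHom

/-- The isomorphism `aHa⁻¹ ≅ H`, `x ↦ a⁻¹xa`. -/
def conjEquiv (a : G) (H : Subgroup G) : conjSubgroup a H ≃* H :=
  ((MulAut.conj a : G ≃* G).subgroupMap H).symm

/-- The conjugate `aHa⁻¹`-set `aT` of an `H`-set `T`: the element `aha⁻¹` acts as `h`. -/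
def conj (a : G) {H : Subgroup G} (T : FinGSet H) : FinGSet (conjSubgroup a H) :=
  T.comap (conjEquiv a H).toMonoidHom

variable [Finite G]

/-- The orbit `H/K` of left cosets, as a finite `H`-set. -/
def orbit (K H : Subgroup G) : FinGSet H where
  carrier := H ⧸ K.subgroupOf H

/-- The equivalence relation on `H × T` generating `H ×_K T`: one has
`(h, t) ∼ (h k⁻¹, k t)` for `k ∈ K`. -/
def indSetoid {K H : Subgroup G} (hKH : K ≤ H) (T : FinGSet K) : Setoid (H × T) where
  r p q := ∃ k : K, q.1 = p.1 * (Subgroup.inclusion hKH k)⁻¹ ∧ q.2 = k • p.2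
  iseqv :=
    { refl := fun p => ⟨1, by simp, by simp⟩
      symm := by
        rintro ⟨h, t⟩ ⟨h', t'⟩ ⟨k, h1, h2⟩
        refine ⟨k⁻¹, ?_, ?_⟩
        · simp only at h1; simp [h1]
        · simp only at h2; simp [h2]
      trans := by
        rintro ⟨h, t⟩ ⟨h', t'⟩ ⟨h'', t''⟩ ⟨k, h1, h2⟩ ⟨l, h3, h4⟩
        refine ⟨l * k, ?_, ?_⟩
        · simp only at h1 h3; simp [h1, h3, mul_assoc]
        · simp only at h2 h4; simp [h2, h4, mul_smul] }

/-- `H` acts on `H ×_K T` through left multiplication on the first factor. -/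
instance indAction {K H : Subgroup G} (hKH : K ≤ H) (T : FinGSet K) :
    MulAction H (Quotient (indSetoid hKH T)) where
  smul x := Quotient.map (fun p => (x * p.1, p.2)) (by
    rintro ⟨h, t⟩ ⟨h', t'⟩ ⟨k, h1, h2⟩
    refine ⟨k, ?_, h2⟩
    simp only at h1
    simp [h1, mul_assoc])
  one_smul := by
    rintro ⟨h, t⟩
    change Quotient.mk _ _ = Quotient.mk _ _
    simp
  mul_smul := by
    rintro x y ⟨h, t⟩
    change Quotient.mk _ _ = Quotient.mk _ _
    simp [mul_assoc]

/-- The induced `H`-set `ind_K^H T = H ×_K T`. -/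
def ind {K H : Subgroup G} (hKH : K ≤ H) (T : FinGSet K) : FinGSet H where
  carrier := Quotient (indSetoid hKH T)

end Subgroups

/-! ## Coefficient systems and indexing systems -/

/-- A coefficient system: for every subgroup `H` of `G` a class of finite `H`-sets that contains
the trivial actions and is closed under isomorphism, restriction and conjugation. -/
@[ext]
structure NCoef (G : Type u) [Group G] where
  sets : ∀ H : Subgroup G, Set (FinGSet H)
  trivial_mem : ∀ (H : Subgroup G) (T : FinGSet H), T.IsTrivial → T ∈ sets H
  iso_mem : ∀ (H : Subgroup G) (S T : FinGSet H), S.IsIso T → S ∈ sets H → T ∈ sets H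
  res_mem : ∀ (K H : Subgroup G) (hKH : K ≤ H) (T : FinGSet H), T ∈ sets H → res hKH T ∈ sets K
  conj_mem : ∀ (H : Subgroup G) (a : G) (T : FinGSet H), T ∈ sets H →
    conj a T ∈ sets (conjSubgroup a H)

namespace NCoef

variable {G : Type u} [Group G]

/-- Coefficient systems are ordered by levelwise inclusion. -/
instance : PartialOrder (NCoef G) where
  le C D := ∀ H, C.sets H ⊆ D.sets H
  le_refl _ _ := subset_rfl
  le_trans _ _ _ h h' H := (h H).trans (h' H)
  le_antisymm _ _ h h' := NCoef.ext (funext fun H => (h H).antisymm (h' H))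

variable [Finite G]

/-- A coefficient system is an indexing system if it is closed under subobjects, finite
coproducts and self-induction. -/
structure IsIndexingSystem (C : NCoef G) : Prop where
  subobject_mem : ∀ (H : Subgroup G) (S T : FinGSet H), S.IsSubobject T →
    T ∈ C.sets H → S ∈ C.sets H
  coprod_mem : ∀ (H : Subgroup G) (ι : Type) [Finite ι] (T : ι → FinGSet H),
    (∀ i, T i ∈ C.sets H) → FinGSet.coprod T ∈ C.sets H
  ind_mem : ∀ (K H : Subgroup G) (hKH : K ≤ H) (T : FinGSet K),
    T ∈ C.sets K → orbit K H ∈ C.sets H → ind hKH T ∈ C.sets H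

/-- The indexing system generated by `C`: the intersection of all indexing systems that
contain `C`. -/
def generated (C : NCoef G) : NCoef G where
  sets H := {T | ∀ F : NCoef G, F.IsIndexingSystem → C ≤ F → T ∈ F.sets H}
  trivial_mem H T hT F _ _ := F.trivial_mem H T hT
  iso_mem H S T e hS F hF hC := F.iso_mem H S T e (hS F hF hC)
  res_mem K H hKH T hT F hF hC := F.res_mem K H hKH T (hT F hF hC)
  conj_mem H a T hT F hF hC := F.conj_mem H a T (hT F hF hC)

/-- `C.generated` is the least indexing system that contains `C`. -/
theorem generated_isLeast (C : NCoef G) :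
    IsLeast {F : NCoef G | F.IsIndexingSystem ∧ C ≤ F} C.generated := by
  refine ⟨⟨⟨?_, ?_, ?_⟩, ?_⟩, ?_⟩
  · exact fun H S T hST hT F hF hC => hF.subobject_mem H S T hST (hT F hF hC)
  · exact fun H ι _ T hT F hF hC => hF.coprod_mem H ι T fun i => hT i F hF hC
  · exact fun K H hKH T hT ho F hF hC => hF.ind_mem K H hKH T (hT F hF hC) (ho F hF hC)
  · exact fun H T hT F _ hC => hC H hT
  · exact fun F hF H T hT => hT F hF.1 hF.2

end NCoef

/-! ## Symmetric sequences of `G`-sets and their admissible sets -/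

/-- A symmetric sequence in `G`-sets: a `(G × Σ_n)`-set for every `n ≥ 0`. -/
structure SymSeq (G : Type u) [Group G] where
  obj : ℕ → Type v
  [action : ∀ n, MulAction (G × Perm (Fin n)) (obj n)]

attribute [instance] SymSeq.action

namespace SymSeq

variable {G : Type u} [Group G]

/-- A map of symmetric sequences: `(G × Σ_n)`-equivariant in every level. -/
@[ext]
structure Hom (A : SymSeq.{u, v} G) (B : SymSeq.{u, w} G) where
  toFun : ∀ n, A.obj n → B.obj n
  map_smul : ∀ (n : ℕ) (p : G × Perm (Fin n)) (x : A.obj n), toFun n (p • x) = p • toFun n x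

/-- The class `N𝐒𝐲𝐦`: all the `Σ_n`-actions are free, and every subgroup `H × {e}` of `G × Σ_n`
has a fixed point. -/
structure IsN (A : SymSeq.{u, v} G) : Prop where
  free : ∀ (n : ℕ) (σ : Perm (Fin n)) (x : A.obj n), ((1, σ) : G × Perm (Fin n)) • x = x → σ = 1
  fixed : ∀ (n : ℕ) (H : Subgroup G),
    (MulAction.fixedPoints (H.prod (⊥ : Subgroup (Perm (Fin n)))) (A.obj n)).Nonempty

/-- The family `{Λ ≤ G × Σ_n | A_n^Λ ≠ ∅}`. -/
def family (A : SymSeq.{u, v} G) (n : ℕ) : Set (Subgroup (G × Perm (Fin n))) :=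
  {Λ | (MulAction.fixedPoints Λ (A.obj n)).Nonempty}

/-- The subgroup `Λ = {(h, α h) | h ∈ H}` of `G × Σ_n`. -/
def graph {H : Subgroup G} {n : ℕ} (α : H →* Perm (Fin n)) : Subgroup (G × Perm (Fin n)) :=
  (H.subtype.prod α).range

theorem mem_family_graph (A : SymSeq.{u, v} G) {H : Subgroup G} {n : ℕ} (α : H →* Perm (Fin n)) :
    graph α ∈ A.family n ↔ ∃ x : A.obj n, ∀ h : H, ((h : G), α h) • x = x := by
  constructor
  · rintro ⟨x, hx⟩
    exact ⟨x, fun h => hx ⟨_, h, rfl⟩⟩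
  · rintro ⟨x, hx⟩
    refine ⟨x, ?_⟩
    rintro ⟨_, h, rfl⟩
    exact hx h

/-- `T` is an admissible `H`-set of `A`: it is isomorphic to `{1, …, n}` with the action given by
some `α : H → Σ_n` such that `A_n` has a point fixed by `{(h, α h) | h ∈ H}`. -/
def IsAdmissible (A : SymSeq.{u, v} G) {H : Subgroup G} (T : FinGSet H) : Prop :=
  ∃ (n : ℕ) (α : H →* Perm (Fin n)), graph α ∈ A.family n ∧
    ∃ e : T ≃ Fin n, ∀ (h : H) (t : T), e (h • t) = α h (e t)

/-- The coefficient system `𝔸(A)` of admissible sets of `A`. -/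
def admissible (A : SymSeq.{u, v} G) (hA : A.IsN) : NCoef G where
  sets _ := {T | A.IsAdmissible T}
  trivial_mem H T hT := by
    refine ⟨Nat.card T, 1, ?_, Finite.equivFin T, fun h t => by simp [hT h t]⟩
    obtain ⟨x, hx⟩ := hA.fixed (Nat.card T) H
    exact (A.mem_family_graph _).2 ⟨x, fun h => hx ⟨(h, 1), by simp [Subgroup.mem_prod]⟩⟩
  iso_mem := by
    rintro H S T ⟨f, hf⟩ ⟨n, α, hα, e, he⟩
    refine ⟨n, α, hα, f.symm.trans e, fun h t => ?_⟩
    obtain ⟨s, rfl⟩ := f.surjective t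
    rw [← hf]
    simp [he]
  res_mem := by
    rintro K H hKH T ⟨n, α, hα, e, he⟩
    obtain ⟨x, hx⟩ := (A.mem_family_graph _).1 hα
    exact ⟨n, α.comp (Subgroup.inclusion hKH),
      (A.mem_family_graph _).2 ⟨x, fun k => hx (Subgroup.inclusion hKH k)⟩,
      e, fun k t => he (Subgroup.inclusion hKH k) t⟩
  conj_mem := by
    rintro H a T ⟨n, α, hα, e, he⟩
    obtain ⟨x, hx⟩ := (A.mem_family_graph _).1 hα
    refine ⟨n, α.comp (conjEquiv a H).toMonoidHom,
      (A.mem_family_graph _).2 ⟨((a, 1) : G × Perm (Fin n)) • x, fun y => ?_⟩,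
      e, fun y t => he (conjEquiv a H y) t⟩
    obtain ⟨h, rfl⟩ := (conjEquiv a H).symm.surjective y
    have h1 : (((conjEquiv a H).symm h : conjSubgroup a H) : G) = a * h * a⁻¹ := rfl
    have h2 : (α.comp (conjEquiv a H).toMonoidHom) ((conjEquiv a H).symm h) = α h := by
      simp
    rw [h1, h2, smul_smul]
    have h3 : ((a * h * a⁻¹, α h) * (a, 1) : G × Perm (Fin n)) = (a, 1) * ((h : G), α h) := by
      simp
    rw [h3, mul_smul, hx h]

/-- Relabelling along a bijection `Fin m ≃ Fin n`. Necessarily `m = n`, and for that `n` this is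
the action of `Σ_n`. -/
def relabel (A : SymSeq.{u, v} G) {m n : ℕ} (e : Fin m ≃ Fin n) (x : A.obj m) : A.obj n :=
  have h : m = n := Fin.equiv_iff_eq.1 ⟨e⟩
  ((1, (finCongr h).symm.trans e) : G × Perm (Fin n)) • (h ▸ x)

theorem relabel_perm (A : SymSeq.{u, v} G) {n : ℕ} (σ : Perm (Fin n)) (x : A.obj n) :
    A.relabel σ x = ((1, σ) : G × Perm (Fin n)) • x := rfl

theorem relabel_relabel (A : SymSeq.{u, v} G) {l m n : ℕ} (e : Fin l ≃ Fin m) (f : Fin m ≃ Fin n)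
    (x : A.obj l) : A.relabel f (A.relabel e x) = A.relabel (e.trans f) x := by
  obtain rfl : l = m := Fin.equiv_iff_eq.1 ⟨e⟩
  obtain rfl : l = n := Fin.equiv_iff_eq.1 ⟨f⟩
  simp only [relabel_perm, smul_smul, Prod.mk_mul_mk, mul_one]
  rfl

theorem relabel_refl (A : SymSeq.{u, v} G) {n : ℕ} (x : A.obj n) :
    A.relabel (Equiv.refl _) x = x := by
  rw [relabel_perm]
  exact one_smul _ x

theorem smul_relabel (A : SymSeq.{u, v} G) {m n : ℕ} (g : G) (e : Fin m ≃ Fin n) (x : A.obj m) :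
    ((g, 1) : G × Perm (Fin n)) • A.relabel e x =
      A.relabel e (((g, 1) : G × Perm (Fin m)) • x) := by
  obtain rfl : m = n := Fin.equiv_iff_eq.1 ⟨e⟩
  simp [relabel_perm, smul_smul]

theorem smul_eq (A : SymSeq.{u, v} G) {n : ℕ} (g : G) (σ : Perm (Fin n)) (x : A.obj n) :
    ((g, σ) : G × Perm (Fin n)) • x = A.relabel σ (((g, 1) : G × Perm (Fin n)) • x) := by
  simp [relabel_perm, smul_smul]

theorem Hom.map_relabel {A : SymSeq.{u, v} G} {B : SymSeq.{u, w} G} (f : A.Hom B) {m n : ℕ}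
    (e : Fin m ≃ Fin n) (x : A.obj m) :
    f.toFun n (A.relabel e x) = B.relabel e (f.toFun m x) := by
  obtain rfl : m = n := Fin.equiv_iff_eq.1 ⟨e⟩
  simp [relabel_perm, f.map_smul]

end SymSeq

/-! ## Operads in `G`-sets

Throughout, the bijection `finSigmaFinEquiv : (Σ i : Fin k, Fin (j i)) ≃ Fin (∑ i, j i)` is the
lexicographic one. -/

/-- The block permutation of `j_1 + ⋯ + j_k` letters: it moves the `i`th block of
`j_{σ 1} + ⋯ + j_{σ k}` to the `(σ i)`th block of `j_1 + ⋯ + j_k`. -/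
def blockPerm {k : ℕ} (σ : Perm (Fin k)) (j : Fin k → ℕ) :
    Fin (∑ i, j (σ i)) ≃ Fin (∑ i, j i) :=
  finSigmaFinEquiv.symm.trans
    ((Equiv.sigmaCongrLeft (β := fun i => Fin (j i)) σ).trans finSigmaFinEquiv)

/-- The block sum `τ_1 ⊕ ⋯ ⊕ τ_k` of permutations. -/
def sumPerm {k : ℕ} {j : Fin k → ℕ} (τ : ∀ i, Perm (Fin (j i))) : Perm (Fin (∑ i, j i)) :=
  finSigmaFinEquiv.symm.trans ((Equiv.sigmaCongrRight τ).trans finSigmaFinEquiv)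

/-- The identification of `j` (a sum with one term) with `j`. -/
def oneSumEquiv (j : ℕ) : Fin (∑ _i : Fin 1, j) ≃ Fin j :=
  finSigmaFinEquiv.symm.trans (Equiv.uniqueSigma fun _ : Fin 1 => Fin j)

/-- The identification of `1 + ⋯ + 1` (with `k` terms) with `k`. -/
def sumOneEquiv (k : ℕ) : Fin (∑ _i : Fin k, 1) ≃ Fin k :=
  finSigmaFinEquiv.symm.trans (Equiv.sigmaUnique (Fin k) fun _ => Fin 1)

/-- The identification of a lexicographically ordered iterated sum with the sum over all the
pairs of indices, ordered lexicographically. -/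
def assocEquiv {k : ℕ} (j : Fin k → ℕ) (l : ∀ i, Fin (j i) → ℕ) :
    Fin (∑ p : Fin (∑ i, j i), l (finSigmaFinEquiv.symm p).1 (finSigmaFinEquiv.symm p).2) ≃
      Fin (∑ i, ∑ m, l i m) :=
  finSigmaFinEquiv.symm.trans <|
    (Equiv.sigmaCongrLeft (β := fun q : Σ i, Fin (j i) => Fin (l q.1 q.2))
      finSigmaFinEquiv.symm).trans <|
    (Equiv.sigmaAssoc fun i m => Fin (l i m)).trans <|
    (Equiv.sigmaCongrRight fun _ => finSigmaFinEquiv).trans finSigmaFinEquiv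

/-- A (symmetric) operad in `G`-sets: composition maps
`γ : O(k) × O(j_1) × ⋯ × O(j_k) → O(j_1 + ⋯ + j_k)` and a unit in `O(1)` that are associative,
unital, `Σ`-equivariant and `G`-equivariant. The relabellings in the unit and associativity laws
are order preserving: they only identify equal numbers. -/
structure GOperad (G : Type u) [Group G] extends SymSeq.{u, v} G where
  unit : obj 1
  comp : ∀ {k : ℕ} {j : Fin k → ℕ}, obj k → (∀ i, obj (j i)) → obj (∑ i, j i)
  unit_comp : ∀ {j : ℕ} (x : obj j),
    toSymSeq.relabel (oneSumEquiv j) (comp unit fun _ : Fin 1 => x) = x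
  comp_unit : ∀ {k : ℕ} (x : obj k),
    toSymSeq.relabel (sumOneEquiv k) (comp x fun _ => unit) = x
  assoc : ∀ {k : ℕ} {j : Fin k → ℕ} {l : ∀ i, Fin (j i) → ℕ} (x : obj k) (y : ∀ i, obj (j i))
    (z : ∀ i (m : Fin (j i)), obj (l i m)),
    toSymSeq.relabel (assocEquiv j l)
        (comp (comp x y) fun p => z (finSigmaFinEquiv.symm p).1 (finSigmaFinEquiv.symm p).2) =
      comp x fun i => comp (y i) (z i)
  perm_comp : ∀ {k : ℕ} {j : Fin k → ℕ} (σ : Perm (Fin k)) (x : obj k) (y : ∀ i, obj (j i)),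
    comp (((1, σ) : G × Perm (Fin k)) • x) y =
      toSymSeq.relabel (blockPerm σ j) (comp x fun i => y (σ i))
  comp_perm : ∀ {k : ℕ} {j : Fin k → ℕ} (τ : ∀ i, Perm (Fin (j i))) (x : obj k)
    (y : ∀ i, obj (j i)),
    (comp x fun i => ((1, τ i) : G × Perm (Fin (j i))) • y i) =
      ((1, sumPerm τ) : G × Perm (Fin (∑ i, j i))) • comp x y
  smul_unit : ∀ g : G, ((g, 1) : G × Perm (Fin 1)) • unit = unit
  smul_comp : ∀ {k : ℕ} {j : Fin k → ℕ} (g : G) (x : obj k) (y : ∀ i, obj (j i)),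
    (comp (((g, 1) : G × Perm (Fin k)) • x) fun i => ((g, 1) : G × Perm (Fin (j i))) • y i) =
      ((g, 1) : G × Perm (Fin (∑ i, j i))) • comp x y

/-- A map of operads in `G`-sets. -/
@[ext]
structure GOperad.Hom {G : Type u} [Group G] (O : GOperad.{u, v} G) (P : GOperad.{u, w} G) extends
    SymSeq.Hom O.toSymSeq P.toSymSeq where
  map_unit : toFun 1 O.unit = P.unit
  map_comp : ∀ {k : ℕ} {j : Fin k → ℕ} (x : O.obj k) (y : ∀ i, O.obj (j i)),
    toFun _ (O.comp x y) = P.comp (toFun k x) fun i => toFun (j i) (y i)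

/-! ## The free operad on a symmetric sequence -/

/-- Formal operadic composites of elements of `A`. -/
inductive OpTerm {G : Type u} [Group G] (A : SymSeq.{u, v} G) : ℕ → Type v
  | unit : OpTerm A 1
  | gen {n : ℕ} (a : A.obj n) : OpTerm A n
  | relabel {m n : ℕ} (e : Fin m ≃ Fin n) (t : OpTerm A m) : OpTerm A n
  | comp {k : ℕ} (j : Fin k → ℕ) (t : OpTerm A k) (s : ∀ i, OpTerm A (j i)) :
      OpTerm A (∑ i, j i)

namespace OpTerm

variable {G : Type u} [Group G] {A : SymSeq.{u, v} G}

/-- The congruence on formal composites generated by the (nonequivariant) operad laws and the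
`Σ`-action on the generators. -/
inductive Rel : ∀ {n : ℕ}, OpTerm A n → OpTerm A n → Prop
  | refl {n : ℕ} (t : OpTerm A n) : Rel t t
  | symm {n : ℕ} {t s : OpTerm A n} : Rel t s → Rel s t
  | trans {n : ℕ} {t s r : OpTerm A n} : Rel t s → Rel s r → Rel t r
  | relabel_congr {m n : ℕ} (e : Fin m ≃ Fin n) {t s : OpTerm A m} :
      Rel t s → Rel (relabel e t) (relabel e s)
  | comp_congr {k : ℕ} {j : Fin k → ℕ} {t t' : OpTerm A k} {s s' : ∀ i, OpTerm A (j i)} :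
      Rel t t' → (∀ i, Rel (s i) (s' i)) → Rel (comp j t s) (comp j t' s')
  | relabel_refl {n : ℕ} (t : OpTerm A n) : Rel (relabel (Equiv.refl _) t) t
  | relabel_relabel {l m n : ℕ} (e : Fin l ≃ Fin m) (f : Fin m ≃ Fin n) (t : OpTerm A l) :
      Rel (relabel f (relabel e t)) (relabel (e.trans f) t)
  | relabel_gen {n : ℕ} (σ : Perm (Fin n)) (a : A.obj n) :
      Rel (relabel σ (gen a)) (gen (((1, σ) : G × Perm (Fin n)) • a))
  | unit_comp {j : ℕ} (t : OpTerm A j) :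
      Rel (relabel (oneSumEquiv j) (comp (fun _ : Fin 1 => j) unit fun _ => t)) t
  | comp_unit {k : ℕ} (t : OpTerm A k) :
      Rel (relabel (sumOneEquiv k) (comp (fun _ => 1) t fun _ => unit)) t
  | assoc {k : ℕ} {j : Fin k → ℕ} {l : ∀ i, Fin (j i) → ℕ} (x : OpTerm A k)
      (y : ∀ i, OpTerm A (j i)) (z : ∀ i (m : Fin (j i)), OpTerm A (l i m)) :
      Rel (relabel (assocEquiv j l) (comp _ (comp j x y) fun p =>
          z (finSigmaFinEquiv.symm p).1 (finSigmaFinEquiv.symm p).2))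
        (comp _ x fun i => comp _ (y i) (z i))
  | perm_comp {k : ℕ} {j : Fin k → ℕ} (σ : Perm (Fin k)) (x : OpTerm A k)
      (y : ∀ i, OpTerm A (j i)) :
      Rel (comp j (relabel σ x) y) (relabel (blockPerm σ j) (comp _ x fun i => y (σ i)))
  | comp_perm {k : ℕ} {j : Fin k → ℕ} (τ : ∀ i, Perm (Fin (j i))) (x : OpTerm A k)
      (y : ∀ i, OpTerm A (j i)) :
      Rel (comp j x fun i => relabel (τ i) (y i)) (relabel (sumPerm τ) (comp j x y))

instance setoid (A : SymSeq.{u, v} G) (n : ℕ) : Setoid (OpTerm A n) where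
  r := Rel
  iseqv := ⟨Rel.refl, Rel.symm, Rel.trans⟩

/-- `g ∈ G` acts on a formal composite through its action on all the generators. -/
def gsmul (g : G) : ∀ {n : ℕ}, OpTerm A n → OpTerm A n
  | _, unit => unit
  | n, gen a => gen (((g, 1) : G × Perm (Fin n)) • a)
  | _, relabel e t => relabel e (gsmul g t)
  | _, comp j t s => comp j (gsmul g t) fun i => gsmul g (s i)

theorem Rel.gsmul (g : G) {n : ℕ} {t s : OpTerm A n} (h : Rel t s) :
    Rel (t.gsmul g) (s.gsmul g) := by
  induction h with
  | refl t => exact .refl _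
  | symm _ ih => exact .symm ih
  | trans _ _ ih ih' => exact .trans ih ih'
  | relabel_congr e _ ih => exact .relabel_congr e ih
  | comp_congr _ _ ih ih' => exact .comp_congr ih ih'
  | relabel_refl t => exact .relabel_refl _
  | relabel_relabel e f t => exact .relabel_relabel e f _
  | relabel_gen σ a =>
    rename_i n
    have := Rel.relabel_gen (A := A) σ (((g, 1) : G × Perm (Fin n)) • a)
    simpa [OpTerm.gsmul, smul_smul] using this
  | unit_comp t => exact .unit_comp _
  | comp_unit t => exact .comp_unit _
  | assoc x y z =>
    exact .assoc (x.gsmul g) (fun i => (y i).gsmul g) fun i m => (z i m).gsmul g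
  | perm_comp σ x y => exact .perm_comp σ _ _
  | comp_perm τ x y => exact .comp_perm τ _ _

theorem gsmul_one {n : ℕ} (t : OpTerm A n) : t.gsmul 1 = t := by
  induction t with
  | unit => rfl
  | gen a => simp only [gsmul]; congr 1; exact one_smul _ a
  | relabel e t ih => simp only [gsmul, ih]
  | comp j t s ih ih' => simp only [gsmul, ih, ih']

theorem gsmul_mul (g h : G) {n : ℕ} (t : OpTerm A n) :
    t.gsmul (g * h) = (t.gsmul h).gsmul g := by
  induction t with
  | unit => rfl
  | gen a => simp [gsmul, smul_smul]
  | relabel e t ih => simp only [gsmul, ih]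
  | comp j t s ih ih' => simp only [gsmul, ih, ih']

end OpTerm

namespace SymSeq

variable {G : Type u} [Group G] (A : SymSeq.{u, v} G)

/-- The `(G × Σ_n)`-action on classes of formal composites. -/
instance freeAction (n : ℕ) : MulAction (G × Perm (Fin n)) (Quotient (OpTerm.setoid A n)) where
  smul p := Quotient.map (fun t => OpTerm.relabel p.2 (t.gsmul p.1))
    fun _ _ h => .relabel_congr _ (h.gsmul _)
  one_smul := by
    rintro ⟨t⟩
    refine Quotient.sound ?_
    change OpTerm.Rel (OpTerm.relabel (Equiv.refl _) (t.gsmul 1)) t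
    rw [OpTerm.gsmul_one]
    exact .relabel_refl t
  mul_smul := by
    rintro ⟨g, σ⟩ ⟨h, τ⟩ ⟨t⟩
    refine Quotient.sound ?_
    change OpTerm.Rel (OpTerm.relabel (τ.trans σ) (t.gsmul (g * h)))
      (OpTerm.relabel σ (OpTerm.relabel τ ((t.gsmul h).gsmul g)))
    rw [OpTerm.gsmul_mul]
    exact .symm (.relabel_relabel _ _ _)

/-- The symmetric sequence underlying the free operad. -/
def freeSymSeq : SymSeq.{u, v} G where
  obj n := Quotient (OpTerm.setoid A n)

/-- The class of a formal composite. -/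
def cls {n : ℕ} (t : OpTerm A n) : A.freeSymSeq.obj n := Quotient.mk _ t

theorem cls_surjective {n : ℕ} (x : A.freeSymSeq.obj n) : ∃ t, A.cls t = x := Quotient.exists_rep x

theorem cls_eq {n : ℕ} {t s : OpTerm A n} (h : OpTerm.Rel t s) : A.cls t = A.cls s :=
  Quotient.sound h

theorem perm_cls {n : ℕ} (σ : Perm (Fin n)) (t : OpTerm A n) :
    ((1, σ) : G × Perm (Fin n)) • A.cls t = A.cls (.relabel σ t) := by
  change A.cls (.relabel σ (t.gsmul 1)) = _
  rw [OpTerm.gsmul_one]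

theorem gsmul_cls {n : ℕ} (g : G) (t : OpTerm A n) :
    ((g, 1) : G × Perm (Fin n)) • A.cls t = A.cls (t.gsmul g) :=
  A.cls_eq (.relabel_refl _)

theorem relabel_cls {m n : ℕ} (e : Fin m ≃ Fin n) (t : OpTerm A m) :
    A.freeSymSeq.relabel e (A.cls t) = A.cls (.relabel e t) := by
  obtain rfl : m = n := Fin.equiv_iff_eq.1 ⟨e⟩
  exact A.perm_cls e t

/-- Composition of classes of formal composites. -/
noncomputable def freeComp {k : ℕ} {j : Fin k → ℕ} (x : A.freeSymSeq.obj k)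
    (y : ∀ i, A.freeSymSeq.obj (j i)) : A.freeSymSeq.obj (∑ i, j i) :=
  A.cls (.comp j (Quotient.out x) fun i => Quotient.out (y i))

theorem freeComp_cls {k : ℕ} {j : Fin k → ℕ} (t : OpTerm A k) (s : ∀ i, OpTerm A (j i)) :
    (A.freeComp (A.cls t) fun i => A.cls (s i)) = A.cls (.comp j t s) :=
  A.cls_eq (.comp_congr (Quotient.mk_out t) fun i => Quotient.mk_out (s i))

theorem exists_cls_family {k : ℕ} {j : Fin k → ℕ} (y : ∀ i, A.freeSymSeq.obj (j i)) :
    ∃ s : ∀ i, OpTerm A (j i), y = fun i => A.cls (s i) := by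
  choose s hs using fun i => A.cls_surjective (y i)
  exact ⟨s, funext fun i => (hs i).symm⟩

/-- The free operad in `G`-sets on the symmetric sequence `A`: formal operadic composites of
elements of `A`, modulo the operad laws. -/
noncomputable def freeOperad : GOperad.{u, v} G where
  toSymSeq := A.freeSymSeq
  unit := A.cls .unit
  comp := A.freeComp
  unit_comp x := by
    obtain ⟨t, rfl⟩ := A.cls_surjective x
    rw [A.freeComp_cls .unit fun _ => t, relabel_cls]
    exact A.cls_eq (.unit_comp t)
  comp_unit x := by
    obtain ⟨t, rfl⟩ := A.cls_surjective x
    rw [A.freeComp_cls t fun _ => .unit, relabel_cls]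
    exact A.cls_eq (.comp_unit t)
  assoc {k j l} x y z := by
    obtain ⟨t, rfl⟩ := A.cls_surjective x
    obtain ⟨s, rfl⟩ := A.exists_cls_family y
    choose r hr using fun i m => A.cls_surjective (z i m)
    obtain rfl : z = fun i m => A.cls (r i m) := by
      funext i m
      exact (hr i m).symm
    simp only [freeComp_cls]
    rw [relabel_cls]
    exact A.cls_eq (.assoc t s r)
  perm_comp σ x y := by
    obtain ⟨t, rfl⟩ := A.cls_surjective x
    obtain ⟨s, rfl⟩ := A.exists_cls_family y
    rw [perm_cls, freeComp_cls, A.freeComp_cls t fun i => s (σ i), relabel_cls]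
    exact A.cls_eq (.perm_comp σ t s)
  comp_perm τ x y := by
    obtain ⟨t, rfl⟩ := A.cls_surjective x
    obtain ⟨s, rfl⟩ := A.exists_cls_family y
    simp only [perm_cls, freeComp_cls]
    exact A.cls_eq (.comp_perm τ t s)
  smul_unit g := A.gsmul_cls g .unit
  smul_comp g x y := by
    obtain ⟨t, rfl⟩ := A.cls_surjective x
    obtain ⟨s, rfl⟩ := A.exists_cls_family y
    simp only [gsmul_cls, freeComp_cls]
    rfl

/-- The unit map `η : A → 𝔽(A)`. -/
def freeUnit : A.Hom A.freeSymSeq where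
  toFun _ a := A.cls (.gen a)
  map_smul n p a := by
    obtain ⟨g, σ⟩ := p
    rw [A.freeSymSeq.smul_eq, gsmul_cls, relabel_cls]
    refine A.cls_eq ((OpTerm.Rel.relabel_gen σ _).trans ?_).symm
    rw [smul_smul]
    simpa using OpTerm.Rel.refl _

/-- Evaluation of formal composites in an operad. -/
def interpret {A : SymSeq.{u, v} G} {P : GOperad.{u, w} G} (f : A.Hom P.toSymSeq) :
    ∀ {n : ℕ}, OpTerm A n → P.obj n
  | _, .unit => P.unit
  | n, .gen a => f.toFun n a
  | _, .relabel e t => P.toSymSeq.relabel e (interpret f t)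
  | _, .comp _ t s => P.comp (interpret f t) fun i => interpret f (s i)

theorem interpret_rel {A : SymSeq.{u, v} G} {P : GOperad.{u, w} G} (f : A.Hom P.toSymSeq)
    {n : ℕ} {t s : OpTerm A n} (h : OpTerm.Rel t s) : interpret f t = interpret f s := by
  induction h with
  | refl t => rfl
  | symm _ ih => exact ih.symm
  | trans _ _ ih ih' => exact ih.trans ih'
  | relabel_congr e _ ih => simp only [interpret, ih]
  | comp_congr _ _ ih ih' => simp only [interpret, ih, ih']
  | relabel_refl t => exact relabel_refl _ _
  | relabel_relabel e f t => exact relabel_relabel _ _ _ _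
  | relabel_gen σ a => exact (f.map_smul _ _ _).symm
  | unit_comp t => exact P.unit_comp _
  | comp_unit t => exact P.comp_unit _
  | assoc x y z =>
    exact P.assoc (interpret f x) (fun i => interpret f (y i)) fun i m => interpret f (z i m)
  | perm_comp σ x y => exact P.perm_comp σ _ _
  | comp_perm τ x y => exact P.comp_perm τ _ _

theorem interpret_gsmul {A : SymSeq.{u, v} G} {P : GOperad.{u, w} G} (f : A.Hom P.toSymSeq)
    (g : G) {n : ℕ} (t : OpTerm A n) :
    interpret f (t.gsmul g) = ((g, 1) : G × Perm (Fin n)) • interpret f t := by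
  induction t with
  | unit => exact (P.smul_unit g).symm
  | gen a => exact f.map_smul _ _ _
  | relabel e t ih => simp only [OpTerm.gsmul, interpret, ih, smul_relabel]
  | comp j t s ih ih' => simp only [OpTerm.gsmul, interpret, ih, ih', P.smul_comp]

/-- The universal property: every map of symmetric sequences from `A` to an operad `P` in `G`-sets
extends along `η` to exactly one map of operads `𝔽(A) → P`. -/
theorem freeOperad_universal (P : GOperad.{u, w} G) (f : A.Hom P.toSymSeq) :
    ∃! F : A.freeOperad.Hom P, ∀ (n : ℕ) (a : A.obj n),
      F.toFun n (A.freeUnit.toFun n a) = f.toFun n a := by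
  refine ⟨{ toFun := fun n => Quotient.lift (interpret f) fun _ _ h => interpret_rel f h,
            map_smul := ?_, map_unit := rfl, map_comp := ?_ }, fun n a => rfl, ?_⟩
  · rintro n ⟨g, σ⟩ ⟨t⟩
    change P.toSymSeq.relabel σ (interpret f (t.gsmul g)) = _
    rw [interpret_gsmul, P.toSymSeq.smul_eq g σ]
  · intro k j x y
    obtain ⟨t, rfl⟩ := A.cls_surjective x
    obtain ⟨s, rfl⟩ := A.exists_cls_family y
    change Quotient.lift (interpret f) _ (A.freeComp (A.cls t) fun i => A.cls (s i)) = _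
    rw [freeComp_cls]
    rfl
  · intro F hF
    have key : ∀ {n : ℕ} (t : OpTerm A n), F.toFun n (A.cls t) = interpret f t := by
      intro n t
      induction t with
      | unit => exact F.map_unit
      | gen a => exact hF _ a
      | relabel e t ih =>
        rw [← relabel_cls]
        refine (F.toHom.map_relabel e (A.cls t)).trans ?_
        rw [ih]
        rfl
      | comp j t s ih ih' =>
        rw [← freeComp_cls]
        refine (F.map_comp (A.cls t) fun i => A.cls (s i)).trans ?_
        simp only [ih, ih']
        rfl
    refine GOperad.Hom.ext ?_
    funext n x
    obtain ⟨t, rfl⟩ := A.cls_surjective x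
    exact key t

end SymSeq

end EquivariantOperad

/-! A formal composite has an underlying tree: nodes carry elements of `A`, leaves carry the inputs.
Up to reordering the inputs of nodes, the operad laws do not change this tree (`Rel.eval`), so an
equation in `𝔽(A)` gives an equivalence of trees; the converse is not needed. Since `Σ_n` acts
freely on `A_n`, the reordering at each node is determined by the labels. Hence a permutation that
preserves a tree fixes all its leaves, and `Σ_n` acts freely on `𝔽(A)` (`IsN.freeOperad`).

For `𝔸(𝔽(A)) ≤ 𝕀(𝔸(A))`, let `H` preserve a tree whose leaves are the points of `T`. Then `H`
permutes the branches at the root through a homomorphism whose graph fixes the root label, so the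
branches form an admissible set `I` of `A`. Sending a leaf to its branch is an equivariant map `T →
I`, whose fibers are the leaves of single branches with the action of stabilizers. Induction on the
tree treats the fibers, and an indexing system contains a total set as soon as it contains base and
fibers (`mem_of_fiber`).

Conversely, the unit `A → 𝔽(A)` preserves fixed points, so by minimality it suffices that the
admissible sets of an operad in `N𝐒𝐲𝐦` form an indexing system. All three closure properties are
instances of one principle (`isAdmissible_of_fiber`): compose an operation for the base with
operations for the fibers. -/

namespace EquivariantOperad

/-! ### Labelled trees up to reordering -/

/-- Trees with nodes labelled by the elements of a symmetric sequence and leaves labelled by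
elements of `Y`. -/
inductive LabelledTree {G : Type u} [Group G] (A : SymSeq.{u, v} G) (Y : Type w) : Type (max v w)
  | leaf (y : Y) : LabelledTree A Y
  | node {n : ℕ} (a : A.obj n) (c : Fin n → LabelledTree A Y) : LabelledTree A Y

namespace LabelledTree

variable {G : Type u} [Group G] {A : SymSeq.{u, v} G} {Y : Type w}

/-- Two trees are equivalent if they differ by reorderings of the inputs of their nodes. -/
def Equivalent : LabelledTree A Y → LabelledTree A Y → Prop
  | leaf y, leaf z => y = z
  | leaf _, node _ _ => False
  | node _ _, leaf _ => False
  | @node _ _ _ _ m a c, @node _ _ _ _ n b d =>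
      ∃ e : Fin m ≃ Fin n, A.relabel e a = b ∧ ∀ i, (c i).Equivalent (d (e i))

theorem Equivalent.refl (w : LabelledTree A Y) : w.Equivalent w := by
  induction w with
  | leaf y => simp [Equivalent]
  | node a c ih =>
    rw [Equivalent]
    exact ⟨Equiv.refl _, A.relabel_refl a, ih⟩

theorem Equivalent.symm {w w' : LabelledTree A Y} (h : w.Equivalent w') : w'.Equivalent w := by
  induction w generalizing w' with
  | leaf y => cases w' <;> simp_all [Equivalent]
  | node a c ih =>
    cases w' with
    | leaf => simp [Equivalent] at h
    | node b d =>
      rw [Equivalent] at h ⊢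
      obtain ⟨e, rfl, h⟩ := h
      refine ⟨e.symm, by rw [A.relabel_relabel, e.self_trans_symm, A.relabel_refl], fun i => ?_⟩
      refine ih _ ?_
      simpa using h (e.symm i)

theorem Equivalent.trans {w w' w'' : LabelledTree A Y} (h : w.Equivalent w')
    (h' : w'.Equivalent w'') : w.Equivalent w'' := by
  induction w generalizing w' w'' with
  | leaf y => cases w' <;> cases w'' <;> simp_all [Equivalent]
  | node a c ih =>
    cases w' with
    | leaf => simp [Equivalent] at h
    | node b d =>
      cases w'' with
      | leaf => simp [Equivalent] at h'
      | node b' d' =>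
        rw [Equivalent] at h h' ⊢
        obtain ⟨e, rfl, h⟩ := h
        obtain ⟨f, rfl, h'⟩ := h'
        exact ⟨e.trans f, (A.relabel_relabel _ _ _).symm, fun i => ih i (h i) (h' (e i))⟩

/-- The set of labels of the leaves. -/
def leaves : LabelledTree A Y → Set Y
  | leaf y => {y}
  | node _ c => ⋃ i, (c i).leaves

theorem Equivalent.leaves_eq {w w' : LabelledTree A Y} (h : w.Equivalent w') :
    w.leaves = w'.leaves := by
  induction w generalizing w' with
  | leaf y => cases w' <;> simp_all [Equivalent, leaves]
  | node a c ih =>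
    cases w' with
    | leaf => simp [Equivalent] at h
    | node b d =>
      rw [Equivalent] at h
      obtain ⟨e, -, h⟩ := h
      simp only [leaves, fun i => ih i (h i)]
      exact e.surjective.iUnion_comp fun i => (d i).leaves

/-- No label occurs at two different leaves. -/
def Linear : LabelledTree A Y → Prop
  | leaf _ => True
  | node _ c => (∀ i, (c i).Linear) ∧ Pairwise fun i j => Disjoint (c i).leaves (c j).leaves

/-- Let `g` act on the nodes, and relabel the leaves by `f`. -/
def act {Y' : Type*} (g : G) (f : Y → Y') : LabelledTree A Y → LabelledTree A Y'
  | leaf y => leaf (f y)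
  | @node _ _ _ _ n a c => node (((g, 1) : G × Perm (Fin n)) • a) fun i => (c i).act g f

theorem leaves_act {Y' : Type*} (g : G) (f : Y → Y') (w : LabelledTree A Y) :
    (w.act g f).leaves = f '' w.leaves := by
  induction w with
  | leaf y => simp [act, leaves]
  | node a c ih => simp [act, leaves, ih, Set.image_iUnion]

/-- If all `Σ_n` act freely, a relabelling that preserves a tree fixes the labels of its leaves. -/
theorem eq_of_act_equivalent (hA : A.IsN) {f : Y → Y} {w : LabelledTree A Y}
    (h : (w.act 1 f).Equivalent w) {y : Y} (hy : y ∈ w.leaves) : f y = y := by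
  induction w with
  | leaf z =>
    rw [act, Equivalent] at h
    rwa [Set.mem_singleton_iff.1 hy]
  | node a c ih =>
    rw [act, Equivalent] at h
    obtain ⟨e, he, h⟩ := h
    -- The group element is `1`, so `e` itself fixes the label `a`, and freeness forces `e = 1`.
    -- Hence each branch is compared with itself.
    obtain rfl : e = 1 := by
      refine hA.free _ e a ?_
      rw [A.relabel_perm, smul_smul] at he
      simpa using he
    obtain ⟨i, hi⟩ := Set.mem_iUnion.1 hy
    exact ih i (h i) hi

end LabelledTree

/-! ### The tree of a formal composite, and freeness of the free operad -/

namespace OpTerm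

open LabelledTree

variable {G : Type u} [Group G] {A : SymSeq.{u, v} G} {Y : Type w}

/-- Graft the trees `v i` onto the inputs of a formal composite. -/
def eval : ∀ {n : ℕ}, OpTerm A n → (Fin n → LabelledTree A Y) → LabelledTree A Y
  | _, unit, v => v 0
  | _, gen a, v => node a v
  | _, relabel e t, v => t.eval fun i => v (e i)
  | _, comp _ t s, v => t.eval fun i => (s i).eval fun m => v (finSigmaFinEquiv ⟨i, m⟩)

theorem eval_congr {n : ℕ} (t : OpTerm A n) {v v' : Fin n → LabelledTree A Y}
    (h : ∀ i, (v i).Equivalent (v' i)) : (t.eval v).Equivalent (t.eval v') := by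
  induction t with
  | unit => exact h 0
  | gen a =>
    rw [eval, eval, Equivalent]
    exact ⟨Equiv.refl _, A.relabel_refl a, h⟩
  | relabel e t ih => exact ih fun i => h _
  | comp j t s ih ih' => exact ih fun i => ih' i fun m => h _

/-- Grafting satisfies the unit, associativity and equivariance laws on the nose: both sides are the
same tree. Only `relabel_gen` reorders the inputs of a node, which is what `Equivalent` allows. -/
theorem Rel.eval {n : ℕ} {t s : OpTerm A n} (h : Rel t s) (v : Fin n → LabelledTree A Y) :
    (t.eval v).Equivalent (s.eval v) := by
  induction h with
  | refl t => exact .refl _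
  | symm _ ih => exact (ih v).symm
  | trans _ _ ih ih' => exact (ih v).trans (ih' v)
  | relabel_congr e _ ih => exact ih _
  | comp_congr _ _ ih ih' => exact (ih _).trans (eval_congr _ fun i => ih' i _)
  | relabel_refl t => exact .refl _
  | relabel_relabel e f t => exact .refl _
  | relabel_gen σ a =>
    simp only [OpTerm.eval]
    rw [Equivalent]
    exact ⟨σ, A.relabel_perm σ a, fun i => .refl _⟩
  | unit_comp t =>
    simp only [OpTerm.eval, oneSumEquiv, Equiv.trans_apply, Equiv.symm_apply_apply]
    exact .refl _
  | comp_unit t =>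
    simp only [OpTerm.eval, sumOneEquiv, Equiv.trans_apply, Equiv.symm_apply_apply]
    exact .refl _
  | @assoc k j l x y z =>
    simp only [OpTerm.eval]
    -- The type of `z` at a position depends on that position, so the position `p` is generalized
    -- together with its equation; `q` can then be substituted.
    suffices h : ∀ (q : Σ i, Fin (j i)) (p : Fin (∑ i, j i)) (hp : p = finSigmaFinEquiv q),
        ((z (finSigmaFinEquiv.symm p).1 (finSigmaFinEquiv.symm p).2).eval fun r =>
          v (assocEquiv j l (finSigmaFinEquiv ⟨p, r⟩))) =
        (z q.1 q.2).eval fun r =>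
          v (finSigmaFinEquiv ⟨q.1, finSigmaFinEquiv ⟨q.2, r⟩⟩) by
      simp only [fun i m => h ⟨i, m⟩ _ rfl]
      exact .refl _
    intro q p hp
    obtain rfl : q = finSigmaFinEquiv.symm p := by simp [hp]
    congr 1
    funext r
    simp [assocEquiv, Equiv.sigmaAssoc]
  | perm_comp σ x y =>
    simp only [OpTerm.eval, blockPerm, Equiv.trans_apply, Equiv.symm_apply_apply]
    exact .refl _
  | comp_perm τ x y =>
    simp only [OpTerm.eval, sumPerm, Equiv.trans_apply, Equiv.symm_apply_apply]
    exact .refl _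

theorem act_eval {Y' : Type*} (g : G) (f : Y → Y') {n : ℕ} (t : OpTerm A n)
    (v : Fin n → LabelledTree A Y) :
    (t.eval v).act g f = (t.gsmul g).eval fun i => (v i).act g f := by
  induction t with
  | unit => rfl
  | gen a => rfl
  | relabel e t ih => exact ih _
  | comp j t s ih ih' => simp only [eval, gsmul, ih, ih']

theorem leaves_eval {n : ℕ} (t : OpTerm A n) (v : Fin n → LabelledTree A Y) :
    (t.eval v).leaves = ⋃ i, (v i).leaves := by
  induction t with
  | unit => ext y; simp [eval, Fin.exists_fin_one]
  | gen a => rfl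
  | relabel e t ih =>
    rw [eval, ih]
    exact e.surjective.iUnion_comp fun i => (v i).leaves
  | comp j t s ih ih' =>
    simp only [eval, ih, ih']
    exact (Set.iUnion_sigma' (γ := fun i => Fin (j i))
      fun i m => (v (finSigmaFinEquiv ⟨i, m⟩)).leaves).trans
        (finSigmaFinEquiv.surjective.iUnion_comp fun i => (v i).leaves)

theorem linear_eval {n : ℕ} (t : OpTerm A n) {v : Fin n → LabelledTree A Y}
    (hv : ∀ i, (v i).Linear) (hd : Pairwise fun i j => Disjoint (v i).leaves (v j).leaves) :
    (t.eval v).Linear := by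
  induction t with
  | unit => exact hv 0
  | gen a => exact ⟨hv, hd⟩
  | relabel e t ih => exact ih (fun i => hv _) fun i j hij => hd (e.injective.ne hij)
  | comp j t s ih ih' =>
    refine ih (fun i => ih' i (fun m => hv _) fun m m' hm => hd ?_) fun i i' hi => ?_
    · exact finSigmaFinEquiv.injective.ne fun h => hm (eq_of_heq (Sigma.mk.inj h).2)
    · simp only [leaves_eval, Set.disjoint_iUnion_left, Set.disjoint_iUnion_right]
      exact fun m m' => hd (finSigmaFinEquiv.injective.ne fun h => hi (Sigma.mk.inj h).1)

end OpTerm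

namespace SymSeq

open LabelledTree

variable {G : Type u} [Group G] (A : SymSeq.{u, v} G)

/-- The passage from fixed points in the quotient to symmetries of trees, on which both freeness and
the upper bound on admissible sets rest. -/
theorem act_eval_equivalent {n : ℕ} {g : G} {σ : Perm (Fin n)} {t : OpTerm A n}
    (h : ((g, σ) : G × Perm (Fin n)) • A.cls t = A.cls t) :
    ((t.eval leaf).act g σ).Equivalent (t.eval leaf) := by
  have h' : OpTerm.Rel (.relabel σ (t.gsmul g)) t := Quotient.exact h
  rw [OpTerm.act_eval]
  exact h'.eval leaf

/-- Every input occurs as a leaf of the tree of `t`, so a permutation preserving this tree is the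
identity. The fixed points come from `A` along the unit. -/
theorem IsN.freeOperad {A : SymSeq.{u, v} G} (hA : A.IsN) : A.freeOperad.toSymSeq.IsN where
  free n σ x hx := by
    obtain ⟨t, rfl⟩ := A.cls_surjective x
    ext i : 1
    refine eq_of_act_equivalent hA (A.act_eval_equivalent hx) ?_
    simp [OpTerm.leaves_eval, leaves]
  fixed n H := by
    obtain ⟨x, hx⟩ := hA.fixed n H
    refine ⟨A.freeUnit.toFun n x, fun p => ?_⟩
    exact (A.freeUnit.map_smul n p x).symm.trans (congrArg _ (hx p))

end SymSeq

end EquivariantOperad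

/-! ### Equivariant maps and their fibers in an indexing system -/

namespace EquivariantOperad

section Fibers

variable {G : Type u} [Group G] {H : Subgroup G}

/-- The stabilizer of a point of an `H`-set, as a subgroup of `G`. -/
def stab (S : FinGSet H) (s : S) : Subgroup G :=
  (MulAction.stabilizer H s).map H.subtype

theorem stab_le (S : FinGSet H) (s : S) : stab S s ≤ H :=
  Subgroup.map_subtype_le _

theorem stab_smul {S : FinGSet H} {s : S} (k : stab S s) :
    Subgroup.inclusion (stab_le S s) k • s = s := by
  obtain ⟨_, h, hh, rfl⟩ := k
  exact hh

theorem mk_mem_stab {S : FinGSet H} {s : S} {h : H} (hh : h • s = s) : (h : G) ∈ stab S s :=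
  ⟨h, hh, rfl⟩

theorem subgroupOf_stab (S : FinGSet H) (s : S) :
    (stab S s).subgroupOf H = MulAction.stabilizer H s :=
  Subgroup.comap_map_eq_self_of_injective H.subtype_injective _

/-- The fiber of an equivariant map over `s`, with the action of the stabilizer of `s`. -/
def fiber {S T : FinGSet H} (p : T → S) (hp : ∀ (h : H) (t : T), p (h • t) = h • p t) (s : S) :
    FinGSet (stab S s) where
  carrier := {t : T // p t = s}
  action :=
    { smul := fun k t => ⟨Subgroup.inclusion (stab_le S s) k • t.1, by
        rw [hp, t.2, stab_smul]⟩
      one_smul := fun t => Subtype.ext (one_smul H t.1)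
      mul_smul := fun k l t => Subtype.ext
        (mul_smul (Subgroup.inclusion (stab_le S s) k) (Subgroup.inclusion (stab_le S s) l) t.1) }

namespace fiber

variable {S T : FinGSet H} {p : T → S} {hp : ∀ (h : H) (t : T), p (h • t) = h • p t} {s : S}

/-- The inclusion of a fiber. -/
def val (t : fiber p hp s) : T := Subtype.val t

/-- A point of the total set, as a point of a fiber. -/
def mk (t : T) (ht : p t = s) : fiber p hp s := Subtype.mk t ht

theorem val_injective : Function.Injective (val : fiber p hp s → T) := Subtype.val_injective

theorem map_val (t : fiber p hp s) : p (val t) = s := Subtype.property t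

theorem val_smul (k : stab S s) (t : fiber p hp s) :
    val (k • t) = Subgroup.inclusion (stab_le S s) k • val t := rfl

end fiber

variable [Finite G]

/-- Orbit-stabilizer: the coset of `x` goes to `x • s`. Thus closure under subobjects supplies the
orbits over which self-induction is permitted. -/
theorem orbit_stab_isSubobject (S : FinGSet H) (s : S) :
    (orbit (stab S s) H).IsSubobject S := by
  have key (x y : H) : (x : H ⧸ (stab S s).subgroupOf H) = y ↔ x • s = y • s := by
    rw [QuotientGroup.eq, subgroupOf_stab, MulAction.mem_stabilizer_iff, mul_smul,
      inv_smul_eq_iff, eq_comm]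
  refine ⟨fun q => Quotient.liftOn' q (fun x => x • s) fun x y h =>
    (key x y).1 (Quotient.sound' h), ?_, ?_⟩
  · rintro ⟨x⟩ ⟨y⟩ h
    exact (key x y).2 h
  · rintro h ⟨x⟩
    exact mul_smul h x s

/-- In an indexing system the total set of an equivariant map is admissible as soon as its base
and its fibers are. -/
theorem NCoef.IsIndexingSystem.mem_of_fiber {C : NCoef G} (hC : C.IsIndexingSystem)
    {S T : FinGSet H} (p : T → S) (hp : ∀ (h : H) (t : T), p (h • t) = h • p t)
    (hS : S ∈ C.sets H) (hT : ∀ s, fiber p hp s ∈ C.sets (stab S s)) : T ∈ C.sets H := by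
  -- `T` is the coproduct, over representatives `r i` of the orbits of `S`, of the sets induced from
  -- the fibers over `r i`. The orbits are numbered because coproducts are indexed by types in
  -- `Type`.
  let Ω := MulAction.orbitRel.Quotient H S
  obtain ⟨N, ⟨idx⟩⟩ := Finite.exists_equiv_fin Ω
  let r : Fin N → S := fun i => (idx.symm i).out
  have hr (s : S) : ∃ i, ∃ h : H, h • r i = s := by
    obtain ⟨h, hh⟩ : s ∈ MulAction.orbit H (Quotient.out (Quotient.mk (MulAction.orbitRel H S) s)) :=
      MulAction.orbitRel_apply.1 ((MulAction.orbitRel H S).symm' (Quotient.mk_out s))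
    exact ⟨idx (Quotient.mk _ s), h, by simpa [r] using hh⟩
  have hr' {i i' : Fin N} {h h' : H} (e : h • r i = h' • r i') : i = i' := by
    refine idx.symm.injective ?_
    rw [← Quotient.out_eq (idx.symm i), ← Quotient.out_eq (idx.symm i')]
    refine Quotient.sound (MulAction.orbitRel_apply.2 ⟨h⁻¹ * h', ?_⟩)
    change (h⁻¹ * h') • r i' = r i
    rw [mul_smul, ← e, inv_smul_smul]
  let F (i : Fin N) : FinGSet H := ind (stab_le S (r i)) (fiber p hp (r i))
  let φ (i : Fin N) : F i → T := Quotient.lift (fun q => q.1 • fiber.val q.2) (by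
    rintro ⟨h, t⟩ ⟨h', t'⟩ ⟨k, h1, h2⟩
    simp only at h1 h2
    subst h1 h2
    change h • fiber.val t = (h * (Subgroup.inclusion _ k)⁻¹) • fiber.val (k • t)
    rw [fiber.val_smul, mul_smul, inv_smul_smul])
  have hφ (i : Fin N) (q : F i) : ∃ h : H, p (φ i q) = h • r i := by
    obtain ⟨h, t⟩ := q
    exact ⟨h, (hp h (fiber.val t)).trans (by rw [fiber.map_val (hp := hp)])⟩
  have hbij : Function.Bijective fun x : FinGSet.coprod F => φ x.1 x.2 := by
    constructor
    · rintro ⟨i, q⟩ ⟨i', q'⟩ e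
      simp only at e
      obtain ⟨h, hh⟩ := hφ i q
      obtain ⟨h', hh'⟩ := hφ i' q'
      obtain rfl : i = i' := hr' (by rw [← hh, ← hh', e])
      congr 1
      obtain ⟨x, t⟩ := q
      obtain ⟨x', t'⟩ := q'
      change x • fiber.val t = x' • fiber.val t' at e
      have hst : (x'⁻¹ * x) • r i = r i := by
        have := congrArg p e
        rw [hp, hp, fiber.map_val (hp := hp), fiber.map_val (hp := hp)] at this
        rw [mul_smul, this, inv_smul_smul]
      refine Quotient.sound ⟨⟨_, mk_mem_stab hst⟩, ?_, fiber.val_injective ?_⟩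
      · change x' = x * (x'⁻¹ * x)⁻¹
        group
      · change fiber.val t' = (x'⁻¹ * x) • fiber.val t
        rw [mul_smul, e, inv_smul_smul]
    · intro t
      obtain ⟨i, h, hh⟩ := hr (p t)
      refine ⟨⟨i, Quotient.mk _ (h, fiber.mk (h⁻¹ • t) (by rw [hp, ← hh, inv_smul_smul]))⟩, ?_⟩
      exact smul_inv_smul h t
  refine C.iso_mem H _ T ⟨Equiv.ofBijective _ hbij, ?_⟩ (hC.coprod_mem H (Fin N) F fun i =>
    hC.ind_mem _ _ _ _ (hT _) (hC.subobject_mem _ _ _ (orbit_stab_isSubobject S _) hS))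
  rintro h ⟨i, x, t⟩
  exact mul_smul h x (fiber.val t)

end Fibers

/-- A homomorphism to a symmetric group is the action on a finite set. -/
theorem FinGSet.exists_of_hom {H : Type u} [Group H] {n : ℕ} (σ : H →* Perm (Fin n)) :
    ∃ (S : FinGSet H) (q : S ≃ Fin n), ∀ (h : H) (s : S), q (h • s) = σ h (q s) :=
  ⟨{ carrier := ULift.{u} (Fin n)
     action :=
      { smul := fun h s => ⟨σ h s.down⟩
        one_smul := fun s => congrArg ULift.up (by rw [map_one, Perm.one_apply])
        mul_smul := fun h k s => congrArg ULift.up (by rw [map_mul, Perm.mul_apply]; rfl) } },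
    Equiv.ulift, fun _ _ => rfl⟩

/-! ### The upper bound: leaves of a preserved tree -/

namespace LabelledTree

variable {G : Type u} [Group G] [Finite G] {A : SymSeq.{u, v} G} {Y : Type w}

/-- If `K` preserves a linear tree, then the `K`-set of its leaves lies in every indexing system
that contains the admissible sets of `A`. -/
theorem leaves_mem (hA : A.IsN) {C : NCoef G} (hC : C.IsIndexingSystem)
    (hAC : A.admissible hA ≤ C) {w : LabelledTree A Y} (hw : w.Linear) {K : Subgroup G}
    {S : FinGSet K} (f : S → Y) (hf : Function.Injective f) (hrange : Set.range f = w.leaves)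
    (hK : ∀ k : K, ∃ r : Y → Y, (∀ s, f (k • s) = r (f s)) ∧ (w.act (k : G) r).Equivalent w) :
    S ∈ C.sets K := by
  induction w generalizing K with
  | leaf y =>
    -- All points of `S` go to `y` under an injection, so `S` has at most one point.
    refine C.trivial_mem K S fun k s => hf ?_
    have h (s : S) : f s = y := hrange.subset (Set.mem_range_self s)
    rw [h, h]
  | @node n a c ih =>
    rw [Linear] at hw
    choose r hr hrw using hK
    simp only [act, Equivalent] at hrw
    choose e he hec using hrw
    have he' (k : K) : (((k : G), e k) : G × Perm (Fin n)) • a = a := by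
      rw [A.smul_eq]
      exact he k
    -- The stabilizer of `a` meets `Σ_n` trivially, so its elements are determined by their
    -- `G`-components. This makes `e` a homomorphism.
    have hfree {σ τ : Perm (Fin n)} {g : G} (hσ : ((g, σ) : G × Perm (Fin n)) • a = a)
        (hτ : ((g, τ) : G × Perm (Fin n)) • a = a) : σ = τ := by
      refine inv_mul_eq_one.1 (hA.free n _ a ?_)
      have : ((1, σ⁻¹ * τ) : G × Perm (Fin n)) = (g, σ)⁻¹ * (g, τ) := by simp
      rw [this, mul_smul, hτ, inv_smul_eq_iff, hσ]
    let σ : K →* Perm (Fin n) := MonoidHom.mk' e fun k l => by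
      refine hfree (he' (k * l)) ?_
      have : (((k * l : K) : G), e k * e l) = ((k : G), e k) * ((l : G), e l) := rfl
      rw [this, mul_smul, he', he']
    obtain ⟨I, q, hq⟩ := FinGSet.exists_of_hom σ
    have hI : I ∈ C.sets K :=
      hAC K ⟨n, σ, (A.mem_family_graph σ).2 ⟨a, he'⟩, q, hq⟩
    have hmem (s : S) : ∃ i : I, f s ∈ (c (q i)).leaves := by
      obtain ⟨i, hi⟩ := Set.mem_iUnion.1 (hrange.subset (Set.mem_range_self s))
      exact ⟨q.symm i, by rwa [q.apply_symm_apply]⟩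
    choose p hp using hmem
    have hp_eq {s : S} {i : I} (h : f s ∈ (c (q i)).leaves) : p s = i := by
      by_contra hne
      exact Set.disjoint_left.1 (hw.2 fun h' => hne (q.injective h')) (hp s) h
    have hpsmul (k : K) (s : S) : p (k • s) = k • p s := by
      refine hp_eq ?_
      rw [hr, hq]
      change _ ∈ (c (e k (q (p s)))).leaves
      rw [← (hec k (q (p s))).leaves_eq, leaves_act]
      exact Set.mem_image_of_mem _ (hp s)
    refine hC.mem_of_fiber p hpsmul hI fun i => ?_
    refine ih (q i) (hw.1 _) (fun s => f (fiber.val s)) (hf.comp fiber.val_injective) ?_ fun k => ?_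
    · ext y
      constructor
      · rintro ⟨s, rfl⟩
        have := hp (fiber.val s)
        rwa [fiber.map_val (hp := hpsmul)] at this
      · intro hy
        obtain ⟨s, rfl⟩ := hrange.superset (Set.mem_iUnion.2 ⟨_, hy⟩)
        exact ⟨fiber.mk s (hp_eq hy), rfl⟩
    -- The relabelling of the whole tree also serves for the branch, since only its values on leaves
    -- matter. An element of the stabilizer of `i` carries the branch `c (q i)` to itself.
    · refine ⟨r (Subgroup.inclusion (stab_le I i) k), fun s => hr _ _, ?_⟩
      have h := hec (Subgroup.inclusion (stab_le I i) k) (q i)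
      have hi : e (Subgroup.inclusion (stab_le I i) k) (q i) = q i :=
        (hq _ _).symm.trans (congrArg q (stab_smul k))
      rwa [hi] at h

end LabelledTree

/-- A fixed operation is represented by a composite `t`; its tree with leaves `1, …, n`, each
occurring once, is preserved by `H`, and `T` is its set of leaves. -/
theorem SymSeq.admissible_freeOperad_le {G : Type u} [Group G] [Finite G] {A : SymSeq.{u, v} G}
    (hA : A.IsN) {C : NCoef G} (hC : C.IsIndexingSystem) (hAC : A.admissible hA ≤ C) :
    A.freeOperad.toSymSeq.admissible hA.freeOperad ≤ C := by
  rintro H T ⟨n, α, hα, e, he⟩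
  obtain ⟨x, hx⟩ := (SymSeq.mem_family_graph _ α).1 hα
  obtain ⟨t, rfl⟩ := A.cls_surjective x
  refine LabelledTree.leaves_mem hA hC hAC (w := t.eval .leaf) ?_ e e.injective ?_
    fun h => ⟨α h, he h, A.act_eval_equivalent (hx h)⟩
  · exact OpTerm.linear_eval t (fun i => trivial) fun i j hij => by
      simpa [LabelledTree.leaves] using hij
  · simp [OpTerm.leaves_eval, LabelledTree.leaves, e.surjective.range_eq, Set.iUnion_of_singleton]

end EquivariantOperad

/-! ### Operations with labelled inputs and their composition -/

namespace EquivariantOperad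

/-- An operation of `A` whose inputs are labelled by elements of `T`. -/
structure LabelledOp {G : Type u} [Group G] (A : SymSeq.{u, v} G) (T : Type w) where
  arity : ℕ
  op : A.obj arity
  label : Fin arity → T

namespace LabelledOp

variable {G : Type u} [Group G] {A : SymSeq.{u, v} G} {T : Type w}

/-- Two labelled operations are equivalent if they differ by a reordering of the inputs. -/
def Equivalent (P Q : LabelledOp A T) : Prop :=
  ∃ e : Fin P.arity ≃ Fin Q.arity, A.relabel e P.op = Q.op ∧ ∀ i, Q.label (e i) = P.label i

theorem Equivalent.trans {P Q R : LabelledOp A T} (h : P.Equivalent Q) (h' : Q.Equivalent R) :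
    P.Equivalent R := by
  obtain ⟨e, he, hel⟩ := h
  obtain ⟨f, hf, hfl⟩ := h'
  exact ⟨e.trans f, by rw [← A.relabel_relabel, he, hf], fun i => (hfl _).trans (hel i)⟩

/-- Apply a map to the labels. -/
def map {T' : Type*} (f : T → T') (P : LabelledOp A T) : LabelledOp A T' :=
  ⟨P.arity, P.op, fun i => f (P.label i)⟩

theorem Equivalent.map {T' : Type*} (f : T → T') {P Q : LabelledOp A T} (h : P.Equivalent Q) :
    (P.map f).Equivalent (Q.map f) := by
  obtain ⟨e, he, hel⟩ := h
  exact ⟨e, he, fun i => congrArg f (hel i)⟩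

variable {H : Subgroup G} [MulAction H T]

/-- `H` acts on labelled operations through the operations and through the labels. -/
instance : MulAction H (LabelledOp A T) where
  smul h P := ⟨P.arity, (((h : G), 1) : G × Perm (Fin P.arity)) • P.op, fun i => h • P.label i⟩
  one_smul P := by
    change LabelledOp.mk _ _ _ = P
    simp only [one_smul]
    congr 1
    exact one_smul _ P.op
  mul_smul h k P := by
    change LabelledOp.mk _ _ _ = LabelledOp.mk _ _ _
    simp only [mul_smul]
    congr 1
    exact (mul_smul (((h : G), 1) : G × Perm (Fin P.arity)) ((k : G), 1) P.op)

theorem smul_def (h : H) (P : LabelledOp A T) :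
    h • P = ⟨P.arity, (((h : G), 1) : G × Perm (Fin P.arity)) • P.op, fun i => h • P.label i⟩ :=
  rfl

theorem Equivalent.smul {P Q : LabelledOp A T} (hPQ : P.Equivalent Q) (h : H) :
    (h • P).Equivalent (h • Q) := by
  obtain ⟨e, he, hel⟩ := hPQ
  exact ⟨e, (A.smul_relabel _ _ _).symm.trans (congrArg _ he), fun i => congrArg (h • ·) (hel i)⟩

end LabelledOp

/-- Extends `comp_perm` to bijections between arities that are equal but not definitionally so, as
they occur in `Equivalent`. -/
theorem GOperad.comp_relabel {G : Type u} [Group G] (O : GOperad.{u, v} G) {k : ℕ}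
    {j j' : Fin k → ℕ} (τ : ∀ i, Fin (j i) ≃ Fin (j' i)) (x : O.obj k) (y : ∀ i, O.obj (j i)) :
    (O.comp x fun i => O.toSymSeq.relabel (τ i) (y i)) =
      O.toSymSeq.relabel (finSigmaFinEquiv.symm.trans
        ((Equiv.sigmaCongrRight τ).trans finSigmaFinEquiv)) (O.comp x y) := by
  obtain rfl : j = j' := funext fun i => Fin.equiv_iff_eq.1 ⟨τ i⟩
  exact O.comp_perm τ x y

namespace LabelledOp

variable {G : Type u} [Group G] {O : GOperad.{u, v} G} {T : Type w}

/-- Substitute labelled operations into an operation. -/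
def comp {k : ℕ} (x : O.obj k) (Q : Fin k → LabelledOp O.toSymSeq T) :
    LabelledOp O.toSymSeq T where
  arity := ∑ i, (Q i).arity
  op := O.comp x fun i => (Q i).op
  label p := (Q (finSigmaFinEquiv.symm p).1).label (finSigmaFinEquiv.symm p).2

theorem label_comp {k : ℕ} (x : O.obj k) (Q : Fin k → LabelledOp O.toSymSeq T)
    (q : Σ i, Fin (Q i).arity) : (comp x Q).label (finSigmaFinEquiv q) = (Q q.1).label q.2 :=
  congrArg (fun q : Σ i, Fin (Q i).arity => (Q q.1).label q.2) (Equiv.symm_apply_apply _ q)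

theorem Equivalent.comp {k : ℕ} (x : O.obj k) {Q R : Fin k → LabelledOp O.toSymSeq T}
    (h : ∀ i, (Q i).Equivalent (R i)) : (comp x Q).Equivalent (comp x R) := by
  choose e he hel using h
  refine ⟨_, (O.comp_relabel e x fun i => (Q i).op).symm.trans ?_, fun p => ?_⟩
  · simp only [he]
    rfl
  · obtain ⟨q, rfl⟩ := (finSigmaFinEquiv (n := fun i => (Q i).arity)).surjective p
    refine Eq.trans (congrArg (LabelledOp.comp x R).label ?_)
      ((label_comp x R ⟨q.1, e q.1 q.2⟩).trans ((hel q.1 q.2).trans (label_comp x Q q).symm))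
    exact congrArg (fun q => finSigmaFinEquiv (Equiv.sigmaCongrRight e q))
      (Equiv.symm_apply_apply finSigmaFinEquiv q)

theorem comp_perm_equivalent {k : ℕ} (σ : Perm (Fin k)) (x : O.obj k)
    (Q : Fin k → LabelledOp O.toSymSeq T) :
    (comp x fun i => Q (σ i)).Equivalent (comp (((1, σ) : G × Perm (Fin k)) • x) Q) := by
  refine ⟨blockPerm σ fun i => (Q i).arity, (O.perm_comp σ x fun i => (Q i).op).symm, fun p => ?_⟩
  obtain ⟨q, rfl⟩ := (finSigmaFinEquiv (n := fun i => (Q (σ i)).arity)).surjective p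
  refine Eq.trans (congrArg (LabelledOp.comp _ Q).label ?_)
    ((label_comp _ Q ⟨σ q.1, q.2⟩).trans (label_comp x (fun i => Q (σ i)) q).symm)
  exact congrArg (fun q => finSigmaFinEquiv
    (Equiv.sigmaCongrLeft (β := fun i => Fin (Q i).arity) σ q))
      (Equiv.symm_apply_apply finSigmaFinEquiv q)

variable {H : Subgroup G} [MulAction H T]

theorem smul_comp (h : H) {k : ℕ} (x : O.obj k) (Q : Fin k → LabelledOp O.toSymSeq T) :
    h • comp x Q = comp ((((h : G), 1) : G × Perm (Fin k)) • x) fun i => h • Q i := by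
  simp only [smul_def, comp, O.smul_comp]

/-- Acting by `h` inside the composite permutes the `Q i` by `σ`; `perm_comp` moves `σ` onto the
outer operation, which then becomes `(h, σ) • x = x`. -/
theorem smul_comp_equivalent (h : H) {k : ℕ} {x : O.obj k} (σ : Perm (Fin k))
    (hx : (((h : G), σ) : G × Perm (Fin k)) • x = x) {Q : Fin k → LabelledOp O.toSymSeq T}
    (hQ : ∀ i, (h • Q i).Equivalent (Q (σ i))) : (h • comp x Q).Equivalent (comp x Q) := by
  rw [smul_comp]
  refine (Equivalent.comp _ hQ).trans ((comp_perm_equivalent σ _ Q).trans ?_)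
  rw [smul_smul, Prod.mk_mul_mk, one_mul, mul_one, hx]
  exact ⟨Equiv.refl _, SymSeq.relabel_refl _ _, fun _ => rfl⟩

end LabelledOp

/-! ### Admissible sets of an operad form an indexing system -/

section Admissible

variable {G : Type u} [Group G] {H : Subgroup G}

/-- A coordinate-free form of admissibility: bijectivity of the labels makes the reordering for each
`h` unique, hence multiplicative in `h`. -/
theorem SymSeq.isAdmissible_iff {A : SymSeq.{u, v} G} {T : FinGSet H} :
    A.IsAdmissible T ↔ ∃ P : LabelledOp A T, P.label.Bijective ∧
      ∀ h : H, (h • P).Equivalent P := by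
  constructor
  · rintro ⟨n, α, hα, e, he⟩
    obtain ⟨x, hx⟩ := (A.mem_family_graph α).1 hα
    refine ⟨⟨n, x, e.symm⟩, e.symm.bijective, fun h => ⟨α h, ?_, fun i => ?_⟩⟩
    · exact (A.smul_eq _ _ _).symm.trans (hx h)
    · change e.symm (α h i) = h • e.symm i
      rw [Equiv.symm_apply_eq, he, Equiv.apply_symm_apply]
  · rintro ⟨⟨n, x, l⟩, hl, hP⟩
    choose σ hσ hσl using hP
    change ∀ h, Perm (Fin n) at σ
    change ∀ h i, l (σ h i) = h • l i at hσl
    refine ⟨n, MonoidHom.mk' σ fun h k => ?_, (A.mem_family_graph _).2 ⟨x, fun h => ?_⟩,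
      (Equiv.ofBijective l hl).symm, fun h t => ?_⟩
    · ext i : 1
      refine hl.1 ?_
      change l (σ (h * k) i) = l (σ h (σ k i))
      rw [hσl, hσl, hσl, mul_smul]
    · exact (A.smul_eq _ _ _).trans (hσ h)
    · rw [Equiv.symm_apply_eq]
      change _ = l (σ h _)
      rw [hσl]
      exact congrArg (h • ·) ((Equiv.ofBijective l hl).apply_symm_apply t).symm

/-- The total set of an equivariant map is admissible for an operad if its base is and if
each fiber labels an operation preserved by the stabilizer. -/
theorem GOperad.isAdmissible_of_fiber (O : GOperad.{u, v} G) {S T : FinGSet H} (p : T → S)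
    (hp : ∀ (h : H) (t : T), p (h • t) = h • p t) (hS : O.toSymSeq.IsAdmissible S)
    (hT : ∀ s, ∃ P : LabelledOp O.toSymSeq T, P.label.Injective ∧ Set.range P.label = p ⁻¹' {s} ∧
      ∀ h : H, h • s = s → (h • P).Equivalent P) : O.toSymSeq.IsAdmissible T := by
  choose P hinj hrange hfix using hT
  -- The given `P s` at different points of an orbit need not be compatible. Only those at orbit
  -- representatives are kept, and `R` translates them along the orbits.
  let r (s : S) : S := (Quotient.mk (MulAction.orbitRel H S) s).out
  have hr_smul (h : H) (s : S) : r (h • s) = r s :=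
    congrArg Quotient.out (Quotient.sound (s := MulAction.orbitRel H S)
      (MulAction.orbitRel_apply.2 (MulAction.mem_orbit s h)))
  have hr (s : S) : ∃ h : H, h • r s = s :=
    MulAction.orbitRel_apply.1 ((MulAction.orbitRel H S).symm' (Quotient.mk_out s))
  choose g hg using hr
  let R (s : S) : LabelledOp O.toSymSeq T := g s • P (r s)
  have hR (h : H) (s : S) : (h • R s).Equivalent (R (h • s)) := by
    -- Both `g (h • s)` and `h * g s` carry the representative to `h • s`, so they differ by an
    -- element of its stabilizer, which preserves `P (r s)`.
    have hst : ((g (h • s))⁻¹ * (h * g s)) • r s = r s := by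
      have := hg (h • s)
      rw [hr_smul] at this
      rw [mul_smul, mul_smul, hg, inv_smul_eq_iff, this]
    have := (hfix (r s) _ hst).smul (g (h • s))
    rw [smul_smul, mul_inv_cancel_left] at this
    simpa only [R, hr_smul, smul_smul] using this
  have hRinj (s : S) : (R s).label.Injective := fun i j hij =>
    hinj (r s) (MulAction.injective (g s) hij)
  have hRrange (s : S) : Set.range (R s).label = p ⁻¹' {s} := by
    ext t
    have h1 : t ∈ Set.range (R s).label ↔ (g s)⁻¹ • t ∈ Set.range (P (r s)).label := by
      constructor
      · rintro ⟨i, rfl⟩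
        exact ⟨i, (inv_smul_smul (g s) _).symm⟩
      · rintro ⟨i, hi⟩
        exact ⟨i, smul_eq_iff_eq_inv_smul _ |>.2 hi⟩
    rw [h1, hrange, Set.mem_preimage, Set.mem_singleton_iff, hp, inv_smul_eq_iff, hg]
    rfl
  obtain ⟨⟨k, x, l⟩, hl, hx⟩ := SymSeq.isAdmissible_iff.1 hS
  refine SymSeq.isAdmissible_iff.2
    ⟨LabelledOp.comp x fun i => R (l i), ⟨fun a b hab => ?_, fun t => ?_⟩, fun h => ?_⟩
  · have hsurj := (finSigmaFinEquiv (n := fun i => (R (l i)).arity)).surjective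
    obtain ⟨⟨i, m⟩, rfl⟩ := hsurj a
    obtain ⟨⟨i', m'⟩, rfl⟩ := hsurj b
    replace hab : (R (l i)).label m = (R (l i')).label m' :=
      (LabelledOp.label_comp x _ _).symm.trans (hab.trans (LabelledOp.label_comp x _ _))
    have hi : p ((R (l i)).label m) = l i := (hRrange (l i)).subset ⟨m, rfl⟩
    have hi' : p ((R (l i')).label m') = l i' := (hRrange (l i')).subset ⟨m', rfl⟩
    obtain rfl : i = i' := hl.1 (hi.symm.trans ((congrArg p hab).trans hi'))
    exact congrArg (fun m => finSigmaFinEquiv ⟨i, m⟩) (hRinj _ hab)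
  · obtain ⟨i, hi⟩ := hl.2 (p t)
    obtain ⟨m, hm⟩ := (hRrange (l i)).superset (show t ∈ _ from hi.symm)
    exact ⟨finSigmaFinEquiv ⟨i, m⟩, (LabelledOp.label_comp x _ _).trans hm⟩
  · obtain ⟨σ, hσ, hσl⟩ := hx h
    refine LabelledOp.smul_comp_equivalent h σ ((O.toSymSeq.smul_eq _ _ _).trans hσ) fun i => ?_
    have : l (σ i) = h • l i := hσl i
    rw [this]
    exact hR h (l i)

variable [Finite G]

/-- The admissible sets of an operad in `N𝐒𝐲𝐦` form an indexing system. -/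
theorem GOperad.admissible_isIndexingSystem (O : GOperad.{u, v} G) (hO : O.toSymSeq.IsN) :
    (O.toSymSeq.admissible hO).IsIndexingSystem where
  subobject_mem := by
    rintro H S T ⟨f, hf, hfs⟩ hT
    refine O.isAdmissible_of_fiber f hfs hT fun t => ?_
    -- A fiber of an injection is a point, labelling the operad unit, or empty, labelling an
    -- `H`-fixed nullary operation.
    by_cases ht : ∃ s, f s = t
    · obtain ⟨s, rfl⟩ := ht
      refine ⟨⟨1, O.unit, fun _ => s⟩, Function.injective_of_subsingleton _, ?_, fun h hs => ?_⟩
      · ext s'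
        simp [hf.eq_iff, eq_comm]
      · have hs' : h • s = s := hf (by rw [hfs, hs])
        exact ⟨Equiv.refl _, (O.toSymSeq.relabel_refl _).trans (O.smul_unit _), fun _ => hs'.symm⟩
    · obtain ⟨x, hx⟩ := hO.fixed 0 H
      refine ⟨⟨0, x, Fin.elim0⟩, Function.injective_of_subsingleton _, ?_, fun h _ => ?_⟩
      · ext s'
        simpa using fun h => ht ⟨s', h⟩
      · exact ⟨Equiv.refl _, (O.toSymSeq.relabel_refl _).trans
          (hx ⟨((h : G), 1), by simp [Subgroup.mem_prod]⟩), fun i => i.elim0⟩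
  coprod_mem := by
    intro H ι _ T hT
    let S : FinGSet H :=
      { carrier := ULift.{u} ι
        action := { smul := fun _ s => s, one_smul := fun _ => rfl, mul_smul := fun _ _ _ => rfl } }
    refine O.isAdmissible_of_fiber (S := S) (fun t => ⟨t.1⟩) (fun _ _ => rfl)
      ((O.toSymSeq.admissible hO).trivial_mem H S fun _ _ => rfl) fun ⟨i⟩ => ?_
    obtain ⟨P, hP, hfix⟩ := SymSeq.isAdmissible_iff.1 (hT i)
    refine ⟨P.map (Sigma.mk i), sigma_mk_injective.comp hP.1, ?_, fun h _ => (hfix h).map _⟩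
    ext ⟨i', t⟩
    constructor
    · rintro ⟨m, hm⟩
      exact congrArg ULift.up (Sigma.mk.inj hm).1.symm
    · intro h
      obtain rfl : i' = i := congrArg ULift.down h
      obtain ⟨m, rfl⟩ := hP.2 t
      exact ⟨m, rfl⟩
  ind_mem := by
    intro K H hKH T hT ho
    let p : ind hKH T → orbit K H := Quotient.lift (fun q => (q.1 : H ⧸ K.subgroupOf H)) (by
      rintro ⟨h, t⟩ ⟨h', t'⟩ ⟨k, h1, h2⟩
      simp only at h1
      subst h1
      exact QuotientGroup.eq.2 (by
        rw [inv_mul_cancel_left]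
        exact Subgroup.mem_subgroupOf.2 (inv_mem k.2)))
    have hp (h : H) (q : ind hKH T) : p (h • q) = h • p q := by
      obtain ⟨x, t⟩ := q
      rfl
    refine O.isAdmissible_of_fiber p hp ho fun s => ?_
    obtain ⟨x, rfl⟩ := QuotientGroup.mk_surjective s
    obtain ⟨P, hP, hfix⟩ := SymSeq.isAdmissible_iff.1 hT
    -- `f` identifies `T` with the fiber over the trivial coset; the fiber over the coset of `x` is
    -- its translate by `x`.
    let f (t : T) : ind hKH T := Quotient.mk (indSetoid hKH T) (1, t)
    have hf : f.Injective := fun t t' h => by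
      obtain ⟨k, h1, h2⟩ := Quotient.exact h
      simp only [one_mul] at h1 h2
      obtain rfl : k = 1 := by
        have := congrArg (fun z : H => (z : G)) h1
        simpa [eq_comm] using this
      rw [h2, one_smul]
    have hfsmul (k : K) (t : T) : f (k • t) = Subgroup.inclusion hKH k • f t := by
      refine (Quotient.sound (s := indSetoid hKH T) ⟨k, ?_, rfl⟩).symm
      simp
    refine ⟨x • P.map f, fun i i' hi => hP.1 (hf (MulAction.injective x hi)), ?_, fun h hs => ?_⟩
    · ext q
      constructor
      · rintro ⟨i, rfl⟩
        exact congrArg (QuotientGroup.mk (s := K.subgroupOf H)) (mul_one x)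
      · obtain ⟨y, t⟩ := q
        intro hy
        have hk : ((x⁻¹ * y : H) : G) ∈ K :=
          Subgroup.mem_subgroupOf.1 (QuotientGroup.eq.1 (Eq.symm hy))
        obtain ⟨i, hi⟩ := hP.2 ((⟨_, hk⟩ : K) • t)
        refine ⟨i, ?_⟩
        change x • f (P.label i) = _
        rw [hi, hfsmul]
        refine Quotient.sound ⟨1, ?_, ?_⟩
        · ext
          simp
        · simp
    -- If `h` fixes the coset of `x`, then `x⁻¹ * h * x` lies in `K`, and `K` preserves `P`.
    · have hk : ((x⁻¹ * (h * x) : H) : G) ∈ K :=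
        Subgroup.mem_subgroupOf.1 (QuotientGroup.eq.1 (Eq.symm hs))
      have h1 : (h * x) = x * Subgroup.inclusion hKH ⟨_, hk⟩ := by
        ext
        simp
      rw [smul_smul, h1, mul_smul]
      refine LabelledOp.Equivalent.smul ?_ x
      obtain ⟨e, he, hel⟩ := (hfix ⟨_, hk⟩).map f
      exact ⟨e, he, fun i => (hel i).trans (hfsmul _ _)⟩

end Admissible

theorem SymSeq.admissible_le_freeOperad {G : Type u} [Group G] {A : SymSeq.{u, v} G}
    (hA : A.IsN) :
    A.admissible hA ≤ A.freeOperad.toSymSeq.admissible hA.freeOperad := by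
  rintro H T ⟨n, α, ⟨x, hx⟩, e, he⟩
  refine ⟨n, α, ⟨A.freeUnit.toFun n x, fun p => ?_⟩, e, he⟩
  exact (A.freeUnit.map_smul n p x).symm.trans (congrArg _ (hx p))

end EquivariantOperad

open EquivariantOperad in
/-- For a symmetric sequence `A` in `N𝐒𝐲𝐦` the free operad `𝔽(A)` in `G`-sets is again in
`N𝐒𝐲𝐦`, and `𝔸(𝔽(A)) = 𝕀(𝔸(A))`. -/
theorem theorem2 {G : Type u} [Group G] [Finite G] (A : SymSeq.{u, v} G) (hA : A.IsN) :
    ∃ hF : A.freeOperad.toSymSeq.IsN,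
      A.freeOperad.toSymSeq.admissible hF = (A.admissible hA).generated := by
  have hgen := (A.admissible hA).generated_isLeast
  refine ⟨hA.freeOperad, le_antisymm ?_ ?_⟩
  · exact SymSeq.admissible_freeOperad_le hA hgen.1.1 hgen.1.2
  · exact hgen.2 ⟨A.freeOperad.admissible_isIndexingSystem _, SymSeq.admissible_le_freeOperad hA⟩
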